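/- All graphs are finite, simple and undirected. For a graph $G$ and a vertex $v$, local complementation at $v$ gives the graph $G*v$ obtained from $G$ by replacing $E(G)$ with its symmetric difference with $\{xy : xv, yv\in E(G),\ x\neq y\}$. Pivoting an edge $uv$ of $G$ gives the graph $G\wedge uv=G*u*v*u$. A graph is a pivot-minor of $H$ if it can be obtained from $H$ by a sequence of vertex deletions and pivots of edges. For $X\subseteq V(G)$, the cut-rank of $X$ is the rank over the binary field of the submatrix of the adjacency matrix of $G$ with rows $X$ and columns $V(G)\setminus X$. A rank-decomposition of $G$ is a pair $(T,L)$ of a tree $T$ with at least two vertices in which every vertex has degree $1$ or $3$, and a bijection $L$ from $V(G)$ to the leaves (the vertices of degree $1$) of $T$. Its width is the maximum, over all edges $e$ of $T$, of the cut-rank of the set of vertices of $G$ that $L$ maps to one of the two components of $T\setminus e$. The rank-width of $G$ is the minimum width of a rank-decomposition of $G$ (and $0$ if $|V(G)|\le 1$). The tree-width of $G$ is the minimum, over all tree-decompositions $(T,\{B_t\}_{t\in V(T)})$ of $G$, of $\max_t(|B_t|-1)$. **Theorem.** Let $k$ be a non-negative integer and let $G$ be a graph of rank-width at most $k$ with $|V(G)|\geq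 3$. Then there exists a graph $H$ such that $H$ has a pivot-minor isomorphic to $G$, the tree-width of $H$ is at most $2k$, and $|V(H)|\leq (2k+1)|V(G)|-6k$. -/

import Mathlib

universe u

namespace SimpleGraph

/-- Local complementation of `G` at `v`: the edge set `E` is replaced by its symmetric difference
with the set of all pairs `xy` of distinct neighbours of `v`. -/
def localComplement {V : Type u} (G : SimpleGraph V) (v : V) : SimpleGraph V where
  Adj x y := x ≠ y ∧ Xor (G.Adj x y) (G.Adj x v ∧ G.Adj y v)
  symm := ⟨by
    rintro x y ⟨hne, h⟩
    refine ⟨hne.symm, ?_⟩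
    rwa [G.adj_comm y x, and_comm (a := G.Adj y v)]⟩
  loopless := ⟨fun _ h => h.1 rfl⟩

/-- Pivoting the pair `uv`: local complementation at `u`, then at `v`, then at `u` again. It is
only used when `uv` is an edge. -/
def pivot {V : Type u} (G : SimpleGraph V) (u v : V) : SimpleGraph V :=
  ((G.localComplement u).localComplement v).localComplement u

/-- `IsPivotMinor H G'` : the graph `G'` is obtained from `H` by a (possibly empty) sequence of
edge pivots and vertex deletions. -/
inductive IsPivotMinor {V : Type u} (H : SimpleGraph V) :
    {W : Type u} → SimpleGraph W → Prop
  | refl : IsPivotMinor H H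
  | pivot {W : Type u} {K : SimpleGraph W} (u v : W) :
      IsPivotMinor H K → K.Adj u v → IsPivotMinor H (K.pivot u v)
  | delete {W : Type u} {K : SimpleGraph W} (v : W) :
      IsPivotMinor H K → IsPivotMinor H (K.induce {w | w ≠ v})

open Classical in
/-- The cut-rank of `X`: the rank over the binary field of the submatrix of the adjacency matrix
with rows indexed by `X` and columns indexed by the complement of `X`. -/
noncomputable def cutRank {V : Type u} [Fintype V] (G : SimpleGraph V) (X : Set V) : ℕ :=
  ((G.adjMatrix (ZMod 2)).submatrix
    (fun a : {a // a ∈ X} => (a : V)) (fun b : {b // b ∉ X} => (b : V))).rank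

open Classical in
/-- A leaf is a vertex of degree `1`. -/
def IsLeaf {N : Type u} [Fintype N] (T : SimpleGraph N) (t : N) : Prop :=
  T.degree t = 1

open Classical in
/-- A subcubic tree: a tree with at least two vertices, in which every vertex that is not a leaf
has degree `3`. -/
structure IsSubcubicTree {N : Type u} [Fintype N] (T : SimpleGraph N) : Prop where
  isTree : T.IsTree
  two_le_card : 2 ≤ Fintype.card N
  degree_eq_three : ∀ t, ¬ T.IsLeaf t → T.degree t = 3

/-- A rank-decomposition of `G`: a (finite) subcubic tree together with a bijection from the
vertices of `G` to the leaves of the tree. -/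
structure RankDecomposition {V : Type u} (G : SimpleGraph V) where
  Node : Type u
  [fintypeNode : Fintype Node]
  tree : SimpleGraph Node
  isSubcubicTree : tree.IsSubcubicTree
  leafEquiv : V ≃ {t : Node // tree.IsLeaf t}

/-- The vertices of `G` whose leaf lies in the component containing `x` of the tree with the edge
`xy` removed. -/
def RankDecomposition.side {V : Type u} {G : SimpleGraph V} (D : RankDecomposition G)
    (x y : D.Node) : Set V :=
  {v | (D.tree.deleteEdges {s(x, y)}).Reachable x (D.leafEquiv v)}

/-- The width of a rank-decomposition: the maximum over the edges `xy` of the tree of the cut-rank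
of one of the two sides of `xy`. (Both orientations of the edge are listed; the two sides are
complementary and so have the same cut-rank.) -/
noncomputable def RankDecomposition.width {V : Type u} [Fintype V] {G : SimpleGraph V}
    (D : RankDecomposition G) : ℕ∞ :=
  ⨆ (x : D.Node) (y : D.Node) (_ : D.tree.Adj x y), (G.cutRank (D.side x y) : ℕ∞)

/-- The rank-width: the minimum width of a rank-decomposition, and `0` if there is at most one
vertex (in that case there is no rank-decomposition). -/
noncomputable def rankWidth {V : Type u} [Fintype V] (G : SimpleGraph V) : ℕ∞ :=
  if Fintype.card V ≤ 1 then 0 else ⨅ D : RankDecomposition G, D.width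

/-- A tree-decomposition of `G`: a (finite) tree and a bag of vertices of `G` for each of its
nodes, satisfying the three usual axioms. -/
structure TreeDecomposition {V : Type u} (G : SimpleGraph V) where
  Node : Type u
  [fintypeNode : Fintype Node]
  tree : SimpleGraph Node
  isTree : tree.IsTree
  bag : Node → Finset V
  exists_mem_bag : ∀ v : V, ∃ t, v ∈ bag t
  exists_adj_mem_bag : ∀ u v : V, G.Adj u v → ∃ t, u ∈ bag t ∧ v ∈ bag t
  mem_bag_of_path : ∀ (t₁ t₂ t₃ : Node) (p : tree.Walk t₁ t₃), p.IsPath → t₂ ∈ p.support →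
    ∀ v : V, v ∈ bag t₁ → v ∈ bag t₃ → v ∈ bag t₂

/-- The width of a tree-decomposition: the maximum of `|B_t| - 1` over all nodes `t`. -/
noncomputable def TreeDecomposition.width {V : Type u} {G : SimpleGraph V}
    (D : TreeDecomposition G) : ℕ∞ :=
  ⨆ t : D.Node, (((D.bag t).card - 1 : ℕ) : ℕ∞)

/-- The tree-width: the minimum width of a tree-decomposition. (For the graph without vertices
this gives `0`; for every other graph the truncated subtraction in the width is harmless.) -/
noncomputable def treeWidth {V : Type u} (G : SimpleGraph V) : ℕ∞ :=
  ⨅ D : TreeDecomposition G, D.width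

end SimpleGraph

/-!
Cutting the inner edges of a rank-decomposition turns `G` into a graph `H` of small tree-width. For
a cut `(X, Xᶜ)` of rank `r`, choose `r` vertices `a` of `X` whose rows span the rows of `X` on `Xᶜ`,
and replace the edges across the cut by `r` new edges `a'a''`: the vertex `a'` is joined to those
`x ∈ X` whose row involves `a`, and `a''` is joined to the neighbours of `a` outside `X`. Pivoting
the edges `a'a''` and deleting their ends restores the edges across the cut. Doing this for the
`|V(G)| - 3` inner edges of the tree adds at most `2k (|V(G)| - 3)` vertices. What remains at an
inner node of the tree is a graph on the at most `2k` vertices `b''` of the two lower edges and the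
at most `k` vertices `a'` of the upper edge.

*Pivot-minor.* By `hasPivotMinor_of_elimination`, it suffices that the adjacency matrix of `G` is
obtained from the one of `H` by eliminating the new vertices. The solutions of the linear equations
that certify this are explicit: for a vertex `x` of `G`, the value at `a''` is the coefficient of
`a` in the row of `x` if `x ∈ X`, the value at `a'` is the adjacency of `x` and `a` if `x ∉ X`, the
value at `x` is `1`, and all remaining values vanish.

*Tree-width.* At each inner node, the vertices `a` chosen for the upper edge are among the vertices
`b` chosen for the two lower edges, so that `a'` is joined to the lower copy of `a` and else only to
copies of vertices that are not chosen for the upper edge. Going down the tree, every `a''` is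
exchanged for `a'`, then the copies of the vertices `b` that are not chosen above are added, then
every `a'` is exchanged for the lower copy of `a`; no bag ever has more than `2k + 1` vertices
(`Buildable.exchange`, `Buildable.add_clique`).

*Induction.* A `Piece` collects what the part of `H` below an edge of the tree has to satisfy.
Single vertices give pieces (`Piece.leaf`), two pieces can be joined (`Piece.join`), and a join is
subdivided at its cut by `Piece.shrink`. The tree is rooted at a leaf `v`. At the node next to it,
two pieces and `v` are joined without a further subdivision; so only the `|V(G)| - 3` inner edges
cost vertices.
-/

/-! ### Adjacency over the binary field and pivot-minors -/

namespace SimpleGraph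

/-- The adjacency relation of `G` with values in the binary field. -/
noncomputable def bit {V : Type*} (G : SimpleGraph V) (x y : V) : ZMod 2 :=
  open Classical in if G.Adj x y then 1 else 0

section Bit

variable {V : Type*} (G : SimpleGraph V)

lemma bit_of_adj {x y : V} (h : G.Adj x y) : G.bit x y = 1 := by simp [bit, h]

lemma bit_of_not_adj {x y : V} (h : ¬ G.Adj x y) : G.bit x y = 0 := by simp [bit, h]

lemma bit_ne_zero_iff {x y : V} : G.bit x y ≠ 0 ↔ G.Adj x y := by
  by_cases h : G.Adj x y <;> simp [bit, h]

lemma bit_comm (x y : V) : G.bit x y = G.bit y x := by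
  by_cases h : G.Adj x y
  · rw [G.bit_of_adj h, G.bit_of_adj h.symm]
  · rw [G.bit_of_not_adj h, G.bit_of_not_adj fun h' => h h'.symm]

@[simp] lemma bit_self (x : V) : G.bit x x = 0 := by simp [bit]

lemma ext_bit {G K : SimpleGraph V} (h : ∀ x y, G.bit x y = K.bit x y) : G = K := by
  ext x y
  rw [← bit_ne_zero_iff, ← bit_ne_zero_iff, h]

/-- Away from the pivoted edge `uv`, pivoting toggles `xy` exactly when `x` and `y` are joined to
the two ends of `uv` in an odd number of the two possible ways. -/
lemma bit_pivot {u v x y : V} (huv : G.Adj u v) (hxu : x ≠ u) (hxv : x ≠ v) (hyu : y ≠ u)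
    (hyv : y ≠ v) :
    (G.pivot u v).bit x y = G.bit x y + G.bit x u * G.bit v y + G.bit x v * G.bit u y := by
  have hvu := huv.symm
  have huv' := huv.ne
  rcases eq_or_ne x y with rfl | hxy
  · rw [bit_self, bit_self, bit_comm G v x, bit_comm G u x, mul_comm (G.bit x v), zero_add,
      CharTwo.add_self_eq_zero]
  · simp only [bit, pivot, localComplement, Xor, G.adj_comm v y, G.adj_comm u y]
    by_cases h1 : G.Adj x y <;> by_cases h2 : G.Adj x u <;> by_cases h3 : G.Adj x v <;>
      by_cases h4 : G.Adj y u <;> by_cases h5 : G.Adj y v <;>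
      simp_all [G.adj_comm, eq_comm] <;> decide

end Bit

/-- `K` is isomorphic to a pivot-minor of `H`. -/
def HasPivotMinor {V W : Type u} (H : SimpleGraph V) (K : SimpleGraph W) : Prop :=
  ∃ (U : Type u) (G' : SimpleGraph U), H.IsPivotMinor G' ∧ Nonempty (G' ≃g K)

lemma localComplement_adj_iso {V W : Type*} {G : SimpleGraph V} {K : SimpleGraph W} (i : G ≃g K)
    (v : V) (x y : V) :
    (K.localComplement (i v)).Adj (i x) (i y) ↔ (G.localComplement v).Adj x y := by
  simp [localComplement, i.map_adj_iff]

/-- Local complementation commutes with isomorphisms. -/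
def Iso.localComplement {V W : Type*} {G : SimpleGraph V} {K : SimpleGraph W} (i : G ≃g K)
    (v : V) : G.localComplement v ≃g K.localComplement (i v) :=
  ⟨i.toEquiv, localComplement_adj_iso i v _ _⟩

/-- Pivoting commutes with isomorphisms. -/
def Iso.pivot {V W : Type*} {G : SimpleGraph V} {K : SimpleGraph W} (i : G ≃g K) (u v : V) :
    G.pivot u v ≃g K.pivot (i u) (i v) :=
  ((i.localComplement u).localComplement v).localComplement u

lemma HasPivotMinor.refl {V : Type u} (H : SimpleGraph V) : H.HasPivotMinor H :=
  ⟨V, H, .refl, ⟨Iso.refl⟩⟩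

lemma HasPivotMinor.pivot {V W : Type u} {H : SimpleGraph V} {K : SimpleGraph W}
    (h : H.HasPivotMinor K) {u v : W} (huv : K.Adj u v) : H.HasPivotMinor (K.pivot u v) := by
  obtain ⟨U, G', hG, ⟨i⟩⟩ := h
  refine ⟨U, _, hG.pivot (i.symm u) (i.symm v) (i.symm.map_adj_iff.2 huv), ⟨?_⟩⟩
  have := i.pivot (i.symm u) (i.symm v)
  simpa using this

lemma HasPivotMinor.induce_ne {V W : Type u} {H : SimpleGraph V} {K : SimpleGraph W}
    (h : H.HasPivotMinor K) (v : W) : H.HasPivotMinor (K.induce {w | w ≠ v}) := by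
  obtain ⟨U, G', hG, ⟨i⟩⟩ := h
  refine ⟨_, _, hG.delete (i.symm v), ⟨⟨i.toEquiv.subtypeEquiv fun a => ?_, ?_⟩⟩⟩
  · change a ≠ i.symm v ↔ i a ≠ v
    rw [not_iff_not]
    exact i.toEquiv.eq_symm_apply
  · exact i.map_adj_iff

/-- Deleting several vertices: an induced subgraph of a pivot-minor is a pivot-minor. -/
lemma HasPivotMinor.comap {V W U : Type u} [Finite W] {H : SimpleGraph V} {K : SimpleGraph W}
    (h : H.HasPivotMinor K) (e : U ↪ W) : H.HasPivotMinor (K.comap e) := by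
  induction hn : Nat.card W generalizing W with
  | zero =>
    have : IsEmpty W := (Nat.card_eq_zero.1 hn).resolve_right (fun h => h.not_finite ‹_›)
    have : IsEmpty U := ⟨fun x => this.elim (e x)⟩
    obtain ⟨U', G', hG, ⟨i⟩⟩ := h
    exact ⟨U', G', hG, ⟨⟨i.toEquiv.trans (Equiv.equivOfIsEmpty _ _),
      fun {a} => (IsEmpty.false (i a)).elim⟩⟩⟩
  | succ n ih =>
    by_cases hs : Function.Surjective e
    · obtain ⟨U', G', hG, ⟨i⟩⟩ := h
      let f : U ≃ W := Equiv.ofBijective e ⟨e.injective, hs⟩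
      exact ⟨U', G', hG, ⟨i.trans (Iso.comap f K).symm⟩⟩
    · simp only [Function.Surjective, not_forall, not_exists] at hs
      obtain ⟨v, hv⟩ := hs
      refine ih (h.induce_ne v) ⟨fun x => ⟨e x, hv x⟩, fun x y hxy => ?_⟩ ?_
      · exact e.injective (congrArg Subtype.val hxy)
      · have := Set.ncard_add_ncard_compl {v}
        rw [Set.ncard_singleton, hn] at this
        have h2 : Nat.card {w | w ≠ v} = Set.ncard ({v}ᶜ : Set W) := rfl
        omega

/-- Eliminating a set of vertices over the binary field is taking a pivot-minor: if, for every
vertex `x` of `G`, some vector `z` on the vertices of `K` restricts to the indicator of `x` on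
`V(G)` and is mapped by the adjacency matrix of `K` to a vector that vanishes off `V(G)` and
restricts to the row of `x` in the adjacency matrix of `G`, then `G` is a pivot-minor of `K`.
(This says that the adjacency matrix of `G` is a Schur complement in that of `K`.) -/
lemma hasPivotMinor_of_elimination {V W U : Type u} [Fintype W] {H : SimpleGraph V}
    {K : SimpleGraph W} (h : H.HasPivotMinor K) (G : SimpleGraph U) (e : U ↪ W)
    (hz : ∀ x, ∃ z : W → ZMod 2, z (e x) = 1 ∧ (∀ y, y ≠ x → z (e y) = 0) ∧
      (∀ u, u ∉ Set.range e → ∑ w, K.bit u w * z w = 0) ∧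
      ∀ y, ∑ w, K.bit (e y) w * z w = G.bit x y) :
    H.HasPivotMinor G := by
  classical
  induction hn : Fintype.card W using Nat.strong_induction_on generalizing W with
  | _ n ih =>
    by_cases hedge : ∃ u v, u ∉ Set.range e ∧ v ∉ Set.range e ∧ K.Adj u v
    · obtain ⟨u, v, hu, hv, huv⟩ := hedge
      let P : W → Prop := fun w => w ≠ u ∧ w ≠ v
      let K' := (K.pivot u v).comap (Function.Embedding.subtype P)
      have hK' : H.HasPivotMinor K' := (h.pivot huv).comap _
      let e' : U ↪ Subtype P := ⟨fun x => ⟨e x, fun h => hu ⟨x, h⟩, fun h => hv ⟨x, h⟩⟩,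
        fun x y hxy => e.injective (congrArg Subtype.val hxy)⟩
      -- Sums over all vertices split off the two pivoted ones.
      have hsum : ∀ f : W → ZMod 2, ∑ w, f w = f u + f v + ∑ w : Subtype P, f w := by
        intro f
        have h1 := Finset.sum_subtype (Finset.univ.filter fun w => P w) (p := P)
          (F := inferInstance)
          (by simp) f
        have h2 : (Finset.univ.filter fun w => ¬ P w) = {u, v} := by
          ext w; simp [P]; tauto
        rw [← h1, ← Finset.sum_filter_add_sum_filter_not Finset.univ P, h2,
          Finset.sum_pair huv.ne, add_comm]
      refine ih _ ?_ hK' e' (fun x => ?_) rfl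
      · rw [← hn]
        exact Fintype.card_subtype_lt (x := u) (by simp)
      · obtain ⟨z, hz1, hz2, hz3, hz4⟩ := hz x
        have hKb : ∀ a b : Subtype P, K'.bit a b = K.bit a b + K.bit a u * K.bit v b +
            K.bit a v * K.bit u b := by
          intro a b
          rw [← bit_pivot K huv a.2.1 a.2.2 b.2.1 b.2.2]
          rfl
        have hvu := hz3 u hu
        have huv' := hz3 v hv
        rw [hsum] at hvu huv'
        simp only [bit_self, bit_of_adj K huv, bit_of_adj K huv.symm, zero_mul, one_mul, zero_add,
          add_zero] at hvu huv'
        -- The equations at `u` and `v` determine the values of `z` there.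
        have key : ∀ a : Subtype P, ∑ w : Subtype P, K'.bit a w * z w = ∑ w, K.bit a w * z w := by
          intro a
          rw [hsum, CharTwo.add_eq_zero.1 huv', CharTwo.add_eq_zero.1 hvu]
          simp only [hKb, add_mul, Finset.sum_add_distrib, Finset.mul_sum, mul_assoc]
          ring
        refine ⟨fun w => z w, hz1, hz2, fun w hw => ?_, fun y => ?_⟩
        · rw [key]
          exact hz3 w fun ⟨y, hy⟩ => hw ⟨y, Subtype.ext hy⟩
        · rw [key]
          exact hz4 y
    · -- Without edges among the eliminated vertices, they can simply be deleted.
      push Not at hedge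
      have hsingle : ∀ x (z : W → ZMod 2) u, z (e x) = 1 → (∀ y, y ≠ x → z (e y) = 0) →
          (∀ w, w ∉ Set.range e → K.bit u w = 0) → ∑ w, K.bit u w * z w = K.bit u (e x) := by
        intro x z u h1 h2 h3
        rw [Finset.sum_eq_single (e x) _ (by simp), h1, mul_one]
        intro w _ hw
        by_cases hwe : w ∈ Set.range e
        · obtain ⟨y, rfl⟩ := hwe
          rw [h2 y fun h => hw (h ▸ rfl), mul_zero]
        · rw [h3 w hwe, zero_mul]
      have hzero : ∀ s, s ∉ Set.range e → ∀ y, K.bit s (e y) = 0 := by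
        intro s hs y
        obtain ⟨z, hz1, hz2, hz3, -⟩ := hz y
        rw [← hsingle y z s hz1 hz2 fun w hw => K.bit_of_not_adj (hedge s w hs hw), hz3 s hs]
      have : K.comap e = G := by
        refine ext_bit fun x y => ?_
        obtain ⟨z, hz1, hz2, -, hz4⟩ := hz x
        rw [← hz4 y, hsingle x z (e y) hz1 hz2 fun w hw => by rw [bit_comm, hzero w hw], bit_comm]
        rfl
      exact this ▸ h.comap e

end SimpleGraph

/-! ### Building tree-decompositions vertex by vertex -/

namespace SimpleGraph

/-- The graph obtained from `T` by attaching a new vertex `none` of degree one to `t`. -/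
def addLeaf {N : Type*} (T : SimpleGraph N) (t : N) : SimpleGraph (Option N) :=
  T.map Function.Embedding.some ⊔ edge none (some t)

section AddLeaf

variable {N : Type*} (T : SimpleGraph N) (t : N)

/-- The inclusion of `T` into the graph with a new leaf. -/
def addLeafHom : T →g T.addLeaf t where
  toFun := some
  map_rel' h := Or.inl ((map_adj_apply (f := Function.Embedding.some)).2 h)

lemma addLeaf_adj_none : (T.addLeaf t).Adj none (some t) :=
  Or.inr ((edge_adj ..).2 ⟨Or.inl ⟨rfl, rfl⟩, by simp⟩)

lemma IsTree.addLeaf [Finite N] {T : SimpleGraph N} (hT : T.IsTree) (t : N) :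
    (T.addLeaf t).IsTree := by
  rw [isTree_iff_connected_and_card] at hT ⊢
  refine ⟨⟨fun a b => ?_⟩, ?_⟩
  · have key : ∀ a, (T.addLeaf t).Reachable (some t) a
      | none => (T.addLeaf_adj_none t).reachable.symm
      | some a => (hT.1.preconnected t a).map (T.addLeafHom t)
    exact (key a).symm.trans (key b)
  · have hE : (T.addLeaf t).edgeSet =
        insert s(none, some t) (Function.Embedding.some.sym2Map '' T.edgeSet) := by
      rw [SimpleGraph.addLeaf, edgeSet_sup, edgeSet_map, edgeSet_edge_of_ne (by simp),
        Set.union_singleton]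
    have hnot : s(none, some t) ∉ Function.Embedding.some.sym2Map '' T.edgeSet := by
      rintro ⟨e, -, he⟩
      induction e with
      | _ a b => simp at he
    have h2 : Nat.card (T.addLeaf t).edgeSet = Nat.card T.edgeSet + 1 := by
      rw [Nat.card_coe_set_eq, hE, Set.ncard_insert_of_notMem hnot,
        Set.ncard_image_of_injective _ (Function.Embedding.injective _), Nat.card_coe_set_eq]
    rw [h2, Finite.card_option, hT.2]

end AddLeaf

open Classical in
/-- `Buildable H w R 𝓑` : the vertex set `R` of `H` can be built up by adding vertices one at a
time, where the earlier neighbours of a new vertex lie in a set `C` of at most `w` vertices that is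
contained in a bag recorded before; then `C` with the new vertex is recorded as a bag. The family
`𝓑` consists of the recorded bags. These are the bags of a tree-decomposition of width at most `w`
of the subgraph induced by `R`. -/
inductive Buildable {W : Type u} (H : SimpleGraph W) (w : ℕ) : Set W → Set (Finset W) → Prop
  | empty : Buildable H w ∅ {∅}
  | step {R : Set W} {𝓑 : Set (Finset W)} {C₀ C : Finset W} {v : W} (h : Buildable H w R 𝓑)
      (hC₀ : C₀ ∈ 𝓑) (hC : C ⊆ C₀) (hv : v ∉ R) (hw : C.card ≤ w)
      (hadj : ∀ u ∈ R, H.Adj v u → u ∈ C) :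
      Buildable H w (insert v R) (insert (insert v C) 𝓑)

/-- The tree-decomposition recorded by a building sequence. The last conjunct is connectedness of
the set of nodes whose bag contains a given vertex. -/
lemma Buildable.exists_tree {W : Type u} {H : SimpleGraph W} {w : ℕ} {R : Set W}
    {𝓑 : Set (Finset W)} (h : Buildable H w R 𝓑) :
    ∃ (N : Type u) (_ : Fintype N) (T : SimpleGraph N) (bag : N → Finset W), T.IsTree ∧
      (∀ t, ∀ v ∈ bag t, v ∈ R) ∧ (∀ v ∈ R, ∃ t, v ∈ bag t) ∧
      (∀ u ∈ R, ∀ v ∈ R, H.Adj u v → ∃ t, u ∈ bag t ∧ v ∈ bag t) ∧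
      (∀ t, (bag t).card ≤ w + 1) ∧ (∀ C ∈ 𝓑, ∃ t, bag t = C) ∧
      ∀ v t₁ t₂, v ∈ bag t₁ → v ∈ bag t₂ → ∃ p : T.Walk t₁ t₂, ∀ t ∈ p.support, v ∈ bag t := by
  classical
  induction h with
  | empty =>
    refine ⟨PUnit, inferInstance, ⊥, fun _ => ∅, .of_subsingleton, ?_⟩
    simp
  | @step R 𝓑 C₀ C v _ hC₀ hC hv hw hadj ih =>
    obtain ⟨N, _, T, bag, hT, h1, h2, h3, h4, h5, h6⟩ := ih
    obtain ⟨t₀, rfl⟩ := h5 C₀ hC₀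
    have hvbag : ∀ t, v ∉ bag t := fun t ht => hv (h1 t v ht)
    let bag' : Option N → Finset W := fun o => o.elim (insert v C) bag
    -- A walk in the old tree stays a walk with the same bags.
    have hwalk : ∀ x t₁ t₂, x ∈ bag t₁ → x ∈ bag t₂ →
        ∃ p : (T.addLeaf t₀).Walk (some t₁) (some t₂), ∀ t ∈ p.support, x ∈ bag' t := by
      intro x t₁ t₂ hx1 hx2
      obtain ⟨p, hp⟩ := h6 x t₁ t₂ hx1 hx2
      refine ⟨p.map (T.addLeafHom t₀), fun t ht => ?_⟩
      obtain ⟨s, hs, rfl⟩ := List.mem_map.1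
        (show t ∈ p.support.map (T.addLeafHom t₀) by rw [← Walk.support_map]; exact ht)
      exact hp s hs
    have hnone : ∀ x ∈ insert v C, ∀ t, x ∈ bag t →
        ∃ p : (T.addLeaf t₀).Walk none (some t), ∀ s ∈ p.support, x ∈ bag' s := by
      intro x hx t hxt
      have hxC : x ∈ C := (Finset.mem_insert.1 hx).resolve_left fun h => hvbag t (h ▸ hxt)
      obtain ⟨p, hp⟩ := hwalk x t₀ t (hC hxC) hxt
      refine ⟨.cons (T.addLeaf_adj_none t₀) p, fun s hs => ?_⟩
      rw [Walk.support_cons, List.mem_cons] at hs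
      rcases hs with rfl | hs
      · exact hx
      · exact hp s hs
    refine ⟨Option N, inferInstance, T.addLeaf t₀, bag', hT.addLeaf t₀, ?_, ?_, ?_, ?_, ?_, ?_⟩
    · rintro (_ | t) x hx
      · rcases Finset.mem_insert.1 hx with rfl | hx
        · exact Set.mem_insert _ _
        · exact Set.mem_insert_of_mem _ (h1 _ _ (hC hx))
      · exact Set.mem_insert_of_mem _ (h1 _ _ hx)
    · rintro x (rfl | hx)
      · exact ⟨none, Finset.mem_insert_self _ _⟩
      · obtain ⟨t, ht⟩ := h2 x hx
        exact ⟨some t, ht⟩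
    · rintro x (rfl | hx) y (rfl | hy) hxy
      · exact (hxy.ne rfl).elim
      · exact ⟨none, Finset.mem_insert_self _ _, Finset.mem_insert_of_mem (hadj y hy hxy)⟩
      · exact ⟨none, Finset.mem_insert_of_mem (hadj x hx hxy.symm), Finset.mem_insert_self _ _⟩
      · obtain ⟨t, ht⟩ := h3 x hx y hy hxy
        exact ⟨some t, ht⟩
    · rintro (_ | t)
      · exact (Finset.card_insert_le _ _).trans (by omega)
      · exact h4 t
    · rintro D (rfl | hD)
      · exact ⟨none, rfl⟩
      · obtain ⟨t, ht⟩ := h5 D hD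
        exact ⟨some t, ht⟩
    · rintro x (_ | t₁) (_ | t₂) hx1 hx2
      · exact ⟨.nil, fun t ht => by rw [Walk.support_nil, List.mem_singleton] at ht; rwa [ht]⟩
      · exact hnone x hx1 t₂ hx2
      · obtain ⟨p, hp⟩ := hnone x hx2 t₁ hx1
        exact ⟨p.reverse, fun s hs => hp s (by simpa using hs)⟩
      · exact hwalk x t₁ t₂ hx1 hx2

lemma Buildable.treeWidth_le {W : Type u} {H : SimpleGraph W} {w : ℕ} {𝓑 : Set (Finset W)}
    (h : Buildable H w Set.univ 𝓑) : H.treeWidth ≤ (w : ℕ∞) := by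
  classical
  obtain ⟨N, _, T, bag, hT, -, h2, h3, h4, -, h6⟩ := h.exists_tree
  refine (iInf_le _ ({ Node := N, tree := T, isTree := hT, bag := bag
                       exists_mem_bag := fun v => h2 v trivial
                       exists_adj_mem_bag := fun u v => h3 u trivial v trivial
                       mem_bag_of_path := ?_ } : TreeDecomposition H)).trans (iSup_le fun t => ?_)
  · intro t₁ t₂ t₃ p hp ht v hv1 hv3
    obtain ⟨q, hq⟩ := h6 v t₁ t₃ hv1 hv3
    have : p = q.toPath := congrArg Subtype.val
      ((hT.isAcyclic.subsingleton_path t₁ t₃).elim ⟨p, hp⟩ q.toPath)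
    exact hq _ (q.support_toPath_subset_support (this ▸ ht))
  · have := h4 t
    exact_mod_cast (by omega : (bag t).card - 1 ≤ w)

/-- Adding the vertices `h i` for `i ∈ A` to a bag `K`, all neighbours of them being in `K` or among
them. -/
lemma Buildable.add_clique {W : Type u} {H : SimpleGraph W} {w : ℕ} {ι : Type*} {h : ι → W}
    (hinj : Function.Injective h) (A : Finset ι) {R : Set W} {𝓑 : Set (Finset W)}
    (hb : Buildable H w R 𝓑) {C₀ K : Finset W} (hC₀ : C₀ ∈ 𝓑) (hK : K ⊆ C₀)
    (hR : ∀ i ∈ A, h i ∉ R) (hadj : ∀ i ∈ A, ∀ u ∈ R, H.Adj (h i) u → u ∈ K)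
    (hcard : A.card + K.card ≤ w + 1) :
    ∃ 𝓑', 𝓑 ⊆ 𝓑' ∧ Buildable H w (R ∪ h '' A) 𝓑' ∧ ∃ C ∈ 𝓑', (∀ u ∈ K, u ∈ C) ∧
      ∀ i ∈ A, h i ∈ C := by
  classical
  induction A using Finset.induction_on generalizing R 𝓑 C₀ K with
  | empty =>
    exact ⟨𝓑, subset_rfl, by simpa using hb, C₀, hC₀, hK, by simp⟩
  | @insert a A ha ih =>
    rw [Finset.card_insert_of_notMem ha] at hcard
    have hRa : ∀ i ∈ A, h i ∉ insert (h a) R := by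
      rintro i hi (h' | h')
      · exact ha (hinj h' ▸ hi)
      · exact hR i (by simp [hi]) h'
    have hKcard := Finset.card_insert_le (h a) K
    have hb' := hb.step hC₀ hK (hR a (by simp)) (by omega) (hadj a (by simp))
    obtain ⟨𝓑', h1, h2, C, hC, h3, h4⟩ := ih hb' (Set.mem_insert _ _) subset_rfl
      hRa (fun i hi u hu hiu => hu.elim (fun h' => by simp [h'])
        fun hu => Finset.mem_insert_of_mem (hadj i (by simp [hi]) u hu hiu)) (by omega)
    refine ⟨𝓑', (Set.subset_insert _ _).trans h1, ?_, C, hC,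
      fun u hu => h3 u (Finset.mem_insert_of_mem hu), fun i hi => ?_⟩
    · have : R ∪ h '' ↑(insert a A) = insert (h a) R ∪ h '' ↑A := by
        rw [Finset.coe_insert, Set.image_insert_eq, Set.union_insert, Set.insert_union]
      rwa [this]
    · rcases Finset.mem_insert.1 hi with rfl | hi
      · exact h3 _ (Finset.mem_insert_self _ _)
      · exact h4 i hi

/-- Replacing, one at a time, the vertices `g i` of a bag by new vertices `h i`. Apart from the
fixed part `K` of the bag and the other new vertices, `g i` is the only neighbour allowed for `h i`,
so that `g i` may leave the bag once `h i` has entered it. -/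
lemma Buildable.exchange {W : Type u} {H : SimpleGraph W} {w : ℕ} {ι : Type*} {g h : ι → W}
    (hinj : Function.Injective h) (A : Finset ι) {R : Set W} {𝓑 : Set (Finset W)}
    (hb : Buildable H w R 𝓑) {C₀ K : Finset W} (hC₀ : C₀ ∈ 𝓑) (hK : K ⊆ C₀)
    (hg : ∀ i ∈ A, g i ∈ C₀)
    (hR : ∀ i ∈ A, h i ∉ R) (hadj : ∀ i ∈ A, ∀ u ∈ R, H.Adj (h i) u → u = g i ∨ u ∈ K)
    (hcard : A.card + K.card ≤ w) :
    ∃ 𝓑', 𝓑 ⊆ 𝓑' ∧ Buildable H w (R ∪ h '' A) 𝓑' ∧ ∃ C ∈ 𝓑', (∀ u ∈ K, u ∈ C) ∧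
      ∀ i ∈ A, h i ∈ C := by
  classical
  induction A using Finset.induction_on generalizing R 𝓑 C₀ K with
  | empty =>
    exact ⟨𝓑, subset_rfl, by simpa using hb, C₀, hC₀, hK, by simp⟩
  | @insert a A ha ih =>
    rw [Finset.card_insert_of_notMem ha] at hcard
    let D : Finset W := (insert a A).image g ∪ K
    have hD : D ⊆ C₀ := Finset.union_subset
      (fun u hu => by obtain ⟨i, hi, rfl⟩ := Finset.mem_image.1 hu; exact hg i hi) hK
    have hDcard : D.card ≤ w := by
      refine (Finset.card_union_le _ _).trans ?_
      have := Finset.card_image_le (s := insert a A) (f := g)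
      rw [Finset.card_insert_of_notMem ha] at this
      omega
    have hRa : ∀ i ∈ A, h i ∉ insert (h a) R := by
      rintro i hi (h' | h')
      · exact ha (hinj h' ▸ hi)
      · exact hR i (by simp [hi]) h'
    have hKcard := Finset.card_insert_le (h a) K
    have hb' := hb.step hC₀ hD (hR a (by simp)) hDcard fun u hu hau => by
      rcases hadj a (by simp) u hu hau with rfl | h'
      · exact Finset.mem_union_left _ (Finset.mem_image_of_mem _ (by simp))
      · exact Finset.mem_union_right _ h'
    obtain ⟨𝓑', h1, h2, C, hC, h3, h4⟩ := ih (K := insert (h a) K) hb' (Set.mem_insert _ _)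
      (Finset.insert_subset_insert _ Finset.subset_union_right)
      (fun i hi => Finset.mem_insert_of_mem (Finset.mem_union_left _
        (Finset.mem_image_of_mem _ (Finset.mem_insert_of_mem hi))))
      hRa (fun i hi u hu hiu => hu.elim (fun h' => by simp [h'])
        fun hu => (hadj i (by simp [hi]) u hu hiu).imp_right Finset.mem_insert_of_mem) (by omega)
    refine ⟨𝓑', (Set.subset_insert _ _).trans h1, ?_, C, hC,
      fun u hu => h3 u (Finset.mem_insert_of_mem hu), fun i hi => ?_⟩
    · have : R ∪ h '' ↑(insert a A) = insert (h a) R ∪ h '' ↑A := by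
        rw [Finset.coe_insert, Set.image_insert_eq, Set.union_insert, Set.insert_union]
      rwa [this]
    · rcases Finset.mem_insert.1 hi with rfl | hi
      · exact h3 _ (Finset.mem_insert_self _ _)
      · exact h4 i hi

end SimpleGraph

/-! ### Parts with terminals -/

namespace SimpleGraph

open Classical in
/-- The local part, belonging to a set `X` of vertices of `G`, of a graph of small tree-width from
which `G` arises by pivoting. The vertices in `W` that carry a vertex of `X` are given by `orig`,
all others are to be pivoted away. The matrix `M` is the
adjacency matrix of the part. The part is linked to the rest of the graph through its
terminals `up t` only; the terminal `up t` stands for the vertex `lab t` of `X`. The adjacency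
matrix of `G` has, on `X × Xᶜ`, the rows of the vertices `lab t` as a spanning set, and `coeff`
expresses the other rows through them.

For a vertex `x` of `G`, the vector `z x` is the restriction to this part of the solution that
eliminates the vertices to be pivoted away. If `x ∈ X`, the other parts send nothing into this part
and `z x` shows the coefficients of `x` on the terminals. If `x ∉ X`, then `z x` vanishes on the
terminals, and the other parts contribute the adjacency of `x` with `lab t` at the terminal
`up t`.

The last field says that a tree-decomposition of width `w` with a bag containing the terminals can
be extended to the whole part. -/
structure Piece {V : Type u} (G : SimpleGraph V) (w : ℕ) (X : Set V) where
  W : Type u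
  T : Type u
  [fintypeW : Fintype W]
  [fintypeT : Fintype T]
  M : W → W → ZMod 2
  M_symm : ∀ u v, M u v = M v u
  M_self : ∀ u, M u u = 0
  up : T → W
  up_injective : Function.Injective up
  lab : T → V
  lab_mem : ∀ t, lab t ∈ X
  coeff : V → T → ZMod 2
  row_eq : ∀ x ∈ X, ∀ y ∉ X, G.bit x y = ∑ t, coeff x t * G.bit (lab t) y
  orig : W → Option V
  mem_of_orig : ∀ u y, orig u = some y → y ∈ X
  exists_orig : ∀ y ∈ X, ∃ u, orig u = some y
  orig_inj : ∀ u v y, orig u = some y → orig v = some y → u = v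
  z : V → W → ZMod 2
  z_orig : ∀ x u y, orig u = some y → z x u = if x = y then 1 else 0
  z_up_of_mem : ∀ x ∈ X, ∀ t, z x (up t) = coeff x t
  z_up_of_notMem : ∀ x ∉ X, ∀ t, z x (up t) = 0
  sum_of_mem : ∀ x ∈ X, ∀ u, ∑ v, M u v * z x v = (orig u).elim 0 (G.bit x)
  sum_of_notMem : ∀ x ∉ X, ∀ u, ∑ v, M u v * z x v +
    ∑ t, (if u = up t then G.bit x (lab t) else 0) = (orig u).elim 0 (G.bit x)
  build : ∀ {W' : Type u} (H : SimpleGraph W') (f : W → W'), Function.Injective f →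
    (∀ u v, M u v = 0 → ¬ H.Adj (f u) (f v)) → ∀ (R : Set W') (𝓑 : Set (Finset W')),
    Buildable H w R 𝓑 → (∀ t, f (up t) ∈ R) → (∀ u, u ∉ Set.range up → f u ∉ R) →
    (∃ C ∈ 𝓑, ∀ t, f (up t) ∈ C) →
    (∀ r ∈ R, ∀ u, u ∉ Set.range up → H.Adj (f u) r → ∃ t, r = f (up t)) →
    ∃ 𝓑', 𝓑 ⊆ 𝓑' ∧ Buildable H w (R ∪ Set.range f) 𝓑'

attribute [instance] Piece.fintypeW Piece.fintypeT

open Classical in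
/-- The matrix that links the terminals `a s` to the terminals `b t` by the matrix `B`. -/
noncomputable def link {S T W W' : Type*} [Fintype S] [Fintype T] (a : S → W) (b : T → W')
    (B : S → T → ZMod 2) (u : W) (v : W') : ZMod 2 :=
  ∑ s, ∑ t, if u = a s ∧ v = b t then B s t else 0

section Link

variable {S T W W' : Type*} [Fintype S] [Fintype T] (a : S → W) (b : T → W')
    (B : S → T → ZMod 2)

lemma link_swap (u : W) (v : W') : link a b B u v = link b a (fun t s => B s t) v u := by
  classical
  rw [link, link, Finset.sum_comm]
  exact Finset.sum_congr rfl fun t _ => Finset.sum_congr rfl fun s _ =>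
    if_congr and_comm rfl rfl

lemma link_eq_zero_left {u : W} (hu : u ∉ Set.range a) (v : W') : link a b B u v = 0 := by
  refine Finset.sum_eq_zero fun s _ => Finset.sum_eq_zero fun t _ => if_neg ?_
  rintro ⟨rfl, -⟩
  exact hu ⟨s, rfl⟩

variable {a b} in
lemma link_apply (ha : Function.Injective a) (hb : Function.Injective b) (s : S) (t : T) :
    link a b B (a s) (b t) = B s t := by
  classical
  simp only [link, ha.eq_iff, hb.eq_iff, ite_and]
  simp

open Classical in
lemma sum_link_mul [Fintype W'] (z : W' → ZMod 2) (u : W) :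
    ∑ v, link a b B u v * z v = ∑ s, if u = a s then ∑ t, B s t * z (b t) else 0 := by
  simp only [link, Finset.sum_mul]
  rw [Finset.sum_comm]
  refine Finset.sum_congr rfl fun s _ => ?_
  rw [Finset.sum_comm]
  by_cases h : u = a s
  · simp only [h, true_and, if_true]
    refine Finset.sum_congr rfl fun t _ => ?_
    simp
  · simp [h]

end Link

namespace Piece

variable {V : Type u} {G : SimpleGraph V} {w : ℕ}

open Classical in
/-- The part belonging to a single vertex `v`. It is its own terminal, unless `p` fails, which
requires `v` to be isolated. -/
noncomputable def leaf (G : SimpleGraph V) (w : ℕ) (v : V) (p : Prop)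
    (hp : ¬ p → ∀ y, G.bit v y = 0) : Piece G w {v} where
  W := PUnit
  T := {_t : PUnit.{u + 1} // p}
  M _ _ := 0
  M_symm _ _ := rfl
  M_self _ := rfl
  up _ := PUnit.unit
  up_injective _ _ _ := Subtype.ext rfl
  lab _ := v
  lab_mem _ := rfl
  coeff _ _ := 1
  row_eq := by
    rintro x rfl y -
    by_cases h : p
    · simp [h]
    · simp [hp h]
  orig _ := some v
  mem_of_orig _ y h := (Option.some.inj h).symm
  exists_orig y hy := ⟨PUnit.unit, congrArg some hy.symm⟩
  orig_inj _ _ _ _ _ := rfl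
  z x _ := if x = v then 1 else 0
  z_orig x _ y h := by rw [Option.some.inj h]
  z_up_of_mem x hx _ := if_pos hx
  z_up_of_notMem x hx _ := if_neg hx
  sum_of_mem := by
    rintro x rfl -
    simp
  sum_of_notMem x _ _ := by
    by_cases h : p
    · simp [h]
    · simp [bit_comm G x v, hp h]
  build := by
    intro W' H f hf hM R 𝓑 hb hup hR hC hadj
    by_cases h : p
    · have : R ∪ Set.range f = R := Set.union_eq_left.2 (by
        rintro _ ⟨u, rfl⟩
        exact hup ⟨u, h⟩)
      exact ⟨𝓑, subset_rfl, by rwa [this]⟩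
    · have hrange : ∀ u, u ∉ Set.range fun _ : {_t : PUnit.{u + 1} // p} => PUnit.unit :=
        fun u ⟨t, _⟩ => h t.2
      obtain ⟨C, hC, -⟩ := hC
      have := hb.step hC (Finset.empty_subset C) (hR PUnit.unit (hrange _)) (by simp)
        fun r hr hr' => by
          obtain ⟨t, -⟩ := hadj r hr _ (hrange _) hr'
          exact (h t.2).elim
      have hRf : R ∪ Set.range f = insert (f PUnit.unit) R := by
        rw [Set.range_unique, Set.union_singleton]
      rw [← hRf] at this
      exact ⟨_, Set.subset_insert _ _, this⟩

open Classical in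
/-- The union of the parts of two disjoint sets, the terminals being linked across as the vertices
they stand for. -/
noncomputable def join {X Y : Set V} (P : Piece G w X) (Q : Piece G w Y) (hXY : Disjoint X Y) :
    Piece G w (X ∪ Y) where
  W := P.W ⊕ Q.W
  T := P.T ⊕ Q.T
  M
    | .inl u, .inl v => P.M u v
    | .inl u, .inr v => link P.up Q.up (fun s t => G.bit (P.lab s) (Q.lab t)) u v
    | .inr u, .inl v => link Q.up P.up (fun t s => G.bit (P.lab s) (Q.lab t)) u v
    | .inr u, .inr v => Q.M u v
  M_symm := by
    rintro (u | u) (v | v)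
    · exact P.M_symm _ _
    · exact link_swap _ _ _ _ _
    · exact link_swap _ _ _ _ _
    · exact Q.M_symm _ _
  M_self := by
    rintro (u | u)
    · exact P.M_self u
    · exact Q.M_self u
  up := Sum.map P.up Q.up
  up_injective := P.up_injective.sumMap Q.up_injective
  lab := Sum.elim P.lab Q.lab
  lab_mem := by
    rintro (t | t)
    · exact Or.inl (P.lab_mem t)
    · exact Or.inr (Q.lab_mem t)
  coeff x := Sum.elim (fun t => if x ∈ X then P.coeff x t else 0)
    (fun t => if x ∈ Y then Q.coeff x t else 0)
  row_eq := by
    rintro x (hx | hx) y hy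
    · have hx' : x ∉ Y := hXY.notMem_of_mem_left hx
      simp [hx, hx', P.row_eq x hx y fun h => hy (Or.inl h)]
    · have hx' : x ∉ X := hXY.notMem_of_mem_right hx
      simp [hx, hx', Q.row_eq x hx y fun h => hy (Or.inr h)]
  orig := Sum.elim P.orig Q.orig
  mem_of_orig := by
    rintro (u | u) y h
    · exact Or.inl (P.mem_of_orig u y h)
    · exact Or.inr (Q.mem_of_orig u y h)
  exists_orig := by
    rintro y (hy | hy)
    · obtain ⟨u, hu⟩ := P.exists_orig y hy
      exact ⟨.inl u, hu⟩
    · obtain ⟨u, hu⟩ := Q.exists_orig y hy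
      exact ⟨.inr u, hu⟩
  orig_inj := by
    rintro (u | u) (v | v) y hu hv
    · exact congrArg _ (P.orig_inj u v y hu hv)
    · exact (hXY.notMem_of_mem_left (P.mem_of_orig u y hu) (Q.mem_of_orig v y hv)).elim
    · exact (hXY.notMem_of_mem_left (P.mem_of_orig v y hv) (Q.mem_of_orig u y hu)).elim
    · exact congrArg _ (Q.orig_inj u v y hu hv)
  z x := Sum.elim (P.z x) (Q.z x)
  z_orig := by
    rintro x (u | u) y h
    · exact P.z_orig x u y h
    · exact Q.z_orig x u y h
  z_up_of_mem := by
    rintro x (hx | hx) (t | t)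
    · simp [hx, P.z_up_of_mem x hx]
    · have hx' : x ∉ Y := hXY.notMem_of_mem_left hx
      simp [hx', Q.z_up_of_notMem x hx']
    · have hx' : x ∉ X := hXY.notMem_of_mem_right hx
      simp [hx', P.z_up_of_notMem x hx']
    · simp [hx, Q.z_up_of_mem x hx]
  z_up_of_notMem := by
    rintro x hx (t | t)
    · exact P.z_up_of_notMem x (fun h => hx (Or.inl h)) t
    · exact Q.z_up_of_notMem x (fun h => hx (Or.inr h)) t
  sum_of_mem := by
    rintro x hx (u | u)
    · simp only [Fintype.sum_sum_type, Sum.elim_inl, Sum.elim_inr, sum_link_mul]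
      by_cases hxX : x ∈ X
      · have hxY : x ∉ Y := hXY.notMem_of_mem_left hxX
        simp [P.sum_of_mem x hxX u, Q.z_up_of_notMem x hxY]
      · have hxY : x ∈ Y := hx.resolve_left hxX
        rw [← P.sum_of_notMem x hxX u]
        congr 1
        refine Finset.sum_congr rfl fun s _ => if_congr Iff.rfl ?_ rfl
        rw [Q.row_eq x hxY _ (hXY.notMem_of_mem_left (P.lab_mem s))]
        refine Finset.sum_congr rfl fun t _ => ?_
        rw [Q.z_up_of_mem x hxY, mul_comm, bit_comm]
    · simp only [Fintype.sum_sum_type, Sum.elim_inl, Sum.elim_inr, sum_link_mul]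
      by_cases hxX : x ∈ X
      · have hxY : x ∉ Y := hXY.notMem_of_mem_left hxX
        rw [← Q.sum_of_notMem x hxY u, add_comm]
        congr 1
        refine Finset.sum_congr rfl fun s _ => if_congr Iff.rfl ?_ rfl
        rw [P.row_eq x hxX _ (hXY.notMem_of_mem_right (Q.lab_mem s))]
        refine Finset.sum_congr rfl fun t _ => ?_
        rw [P.z_up_of_mem x hxX, mul_comm]
      · have hxY : x ∈ Y := hx.resolve_left hxX
        simp [Q.sum_of_mem x hxY u, P.z_up_of_notMem x hxX]
  sum_of_notMem := by
    rintro x hx (u | u)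
    · have hxX : x ∉ X := fun h => hx (Or.inl h)
      have hxY : x ∉ Y := fun h => hx (Or.inr h)
      simp only [Fintype.sum_sum_type, Sum.elim_inl, Sum.elim_inr, sum_link_mul]
      simp [← P.sum_of_notMem x hxX u, Q.z_up_of_notMem x hxY]
    · have hxX : x ∉ X := fun h => hx (Or.inl h)
      have hxY : x ∉ Y := fun h => hx (Or.inr h)
      simp only [Fintype.sum_sum_type, Sum.elim_inl, Sum.elim_inr, sum_link_mul]
      simp [← Q.sum_of_notMem x hxY u, P.z_up_of_notMem x hxX]
  build := by
    intro W' H f hf hM R 𝓑 hb hup hR ⟨C, hC, hCup⟩ hadj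
    have hl : ∀ u, u ∉ Set.range P.up →
        (Sum.inl u : P.W ⊕ Q.W) ∉ Set.range (Sum.map P.up Q.up) := by
      rintro u hu ⟨t | t, ht⟩
      · exact hu ⟨t, Sum.inl.inj ht⟩
      · cases ht
    have hr : ∀ u, u ∉ Set.range Q.up →
        (Sum.inr u : P.W ⊕ Q.W) ∉ Set.range (Sum.map P.up Q.up) := by
      rintro u hu ⟨t | t, ht⟩
      · cases ht
      · exact hu ⟨t, Sum.inr.inj ht⟩
    obtain ⟨𝓑₁, h1, hb1⟩ := P.build H (f ∘ Sum.inl) (hf.comp Sum.inl_injective)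
      (fun u v h => hM _ _ h) R 𝓑 hb (fun t => hup (.inl t)) (fun u hu => hR _ (hl u hu))
      ⟨C, hC, fun t => hCup (.inl t)⟩ (fun r hr u hu hur => by
        obtain ⟨t | t, rfl⟩ := hadj r hr _ (hl u hu) hur
        · exact ⟨t, rfl⟩
        · exact (hM (.inl u) (.inr _) (link_eq_zero_left _ _ _ hu _) hur).elim)
    obtain ⟨𝓑₂, h2, hb2⟩ := Q.build H (f ∘ Sum.inr) (hf.comp Sum.inr_injective)
      (fun u v h => hM _ _ h) _ 𝓑₁ hb1 (fun t => Or.inl (hup (.inr t)))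
      (fun u hu => by
        rintro (h | ⟨v, hv⟩)
        · exact hR _ (hr u hu) h
        · cases hf hv)
      ⟨C, h1 hC, fun t => hCup (.inr t)⟩ (fun r hr' u hu hur => by
        rcases hr' with hr' | ⟨v, rfl⟩
        · obtain ⟨t | t, rfl⟩ := hadj r hr' _ (hr u hu) hur
          · exact (hM (.inr u) (.inl _) (link_eq_zero_left _ _ _ hu _) hur).elim
          · exact ⟨t, rfl⟩
        · exact (hM (.inr u) (.inl _) (link_eq_zero_left _ _ _ hu _) hur).elim)
    refine ⟨𝓑₂, h1.trans h2, ?_⟩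
    rw [Set.union_assoc] at hb2
    rwa [show Set.range f = Set.range (f ∘ Sum.inl) ∪ Set.range (f ∘ Sum.inr) by
      rw [Set.range_comp, Set.range_comp, ← Set.image_union, Set.range_inl_union_range_inr,
        Set.image_univ]]

end Piece

end SimpleGraph

/-! ### Reducing the number of terminals -/

namespace SimpleGraph
namespace Piece

variable {V : Type u} {G : SimpleGraph V} {w : ℕ}

open Classical in
/-- Passing to a smaller set `B` of terminals whose rows still span. Each `a ∈ B` gets two new
vertices joined by an edge, a lower one that collects the coefficients of `a` from the old
terminals, and an upper one that is the new terminal. Since the coefficients `c` fix the elements of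
`B`, the lower vertex of `a` is joined to the old terminal of `a`, and else only to old terminals
outside `B`; this is what allows the bags to stay small. -/
noncomputable def shrink {X : Set V} (P : Piece G w X) (B : Finset P.T) (c : P.T → P.T → ZMod 2)
    (hc : ∀ b ∈ B, ∀ a, a ≠ b → c b a = 0)
    (hrow : ∀ t, ∀ y ∉ X, G.bit (P.lab t) y = ∑ a ∈ B, c t a * G.bit (P.lab a) y)
    (hw : Fintype.card P.T ≤ w) : Piece G w X where
  W := P.W ⊕ (B ⊕ B)
  T := B
  M
    | .inl u, .inl v => P.M u v
    | .inl u, .inr (.inl a) => link P.up id (fun t (a : B) => c t a) u a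
    | .inl _, .inr (.inr _) => 0
    | .inr (.inl a), .inl u => link id P.up (fun (a : B) t => c t a) a u
    | .inr (.inl _), .inr (.inl _) => 0
    | .inr (.inl a), .inr (.inr b) => if a = b then 1 else 0
    | .inr (.inr _), .inl _ => 0
    | .inr (.inr b), .inr (.inl a) => if b = a then 1 else 0
    | .inr (.inr _), .inr (.inr _) => 0
  M_symm := by
    rintro (u | u | u) (v | v | v) <;> try rfl
    · exact P.M_symm _ _
    · exact link_swap _ _ _ _ _
    · exact link_swap _ _ _ _ _
    · exact if_congr eq_comm rfl rfl
    · exact if_congr eq_comm rfl rfl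
  M_self := by
    rintro (u | u | u)
    · exact P.M_self u
    · rfl
    · rfl
  up a := .inr (.inr a)
  up_injective := Sum.inr_injective.comp Sum.inr_injective
  lab a := P.lab a
  lab_mem a := P.lab_mem a
  coeff x a := ∑ t, P.coeff x t * c t a
  row_eq := by
    intro x hx y hy
    rw [P.row_eq x hx y hy]
    simp only [Finset.sum_mul]
    rw [Finset.sum_comm]
    refine Finset.sum_congr rfl fun t _ => ?_
    rw [hrow t y hy, Finset.mul_sum, ← Finset.sum_coe_sort]
    exact Finset.sum_congr rfl fun a _ => (mul_assoc _ _ _).symm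
  orig := Sum.elim P.orig fun _ => none
  mem_of_orig := by
    rintro (u | u) y h
    · exact P.mem_of_orig u y h
    · cases h
  exists_orig y hy := by
    obtain ⟨u, hu⟩ := P.exists_orig y hy
    exact ⟨.inl u, hu⟩
  orig_inj := by
    rintro (u | u) (v | v) y hu hv
    · exact congrArg _ (P.orig_inj u v y hu hv)
    · cases hv
    · cases hu
    · cases hu
  z x := Sum.elim (P.z x) (Sum.elim (fun a => if x ∈ X then 0 else G.bit x (P.lab a))
    (fun a => if x ∈ X then ∑ t, P.coeff x t * c t a else 0))
  z_orig := by
    rintro x (u | u) y h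
    · exact P.z_orig x u y h
    · cases h
  z_up_of_mem x hx t := by simp [hx]
  z_up_of_notMem x hx t := by simp [hx]
  sum_of_mem := by
    rintro x hx (u | a | a)
    · simp [Fintype.sum_sum_type, hx, P.sum_of_mem x hx u]
    · simp only [Fintype.sum_sum_type, Sum.elim_inl, Sum.elim_inr, sum_link_mul, hx, if_true]
      simp only [P.z_up_of_mem x hx]
      simp [mul_comm, CharTwo.add_self_eq_zero]
    · simp [Fintype.sum_sum_type, hx]
  sum_of_notMem := by
    rintro x hx (u | a | a)
    · simp only [Fintype.sum_sum_type, Sum.elim_inl, Sum.elim_inr, sum_link_mul, hx, if_false]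
      rw [← P.sum_of_notMem x hx u]
      have : ∀ t, ∑ a : B, c t a * G.bit x (P.lab a) = G.bit x (P.lab t) := by
        intro t
        rw [bit_comm G x (P.lab t), hrow t x hx, ← Finset.sum_coe_sort B]
        exact Finset.sum_congr rfl fun a _ => by rw [bit_comm G x]
      simp only [id_eq, this]
      simp
    · simp [Fintype.sum_sum_type, hx, sum_link_mul, P.z_up_of_notMem x hx]
    · simp [Fintype.sum_sum_type, hx, CharTwo.add_self_eq_zero]
  build := by
    intro W' H f hf hM R 𝓑 hb hup hR ⟨C, hC, hCup⟩ hadj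
    have hBc : B.card + Bᶜ.card = Fintype.card P.T := Finset.card_add_card_compl B
    have hcards : (Finset.univ : Finset B).card = B.card := by simp
    have hnot : ∀ u, (∀ b, u ≠ .inr (.inr b)) →
        u ∉ Set.range fun a : B => (Sum.inr (Sum.inr a) : P.W ⊕ (B ⊕ B)) :=
      fun u hu ⟨b, hb⟩ => hu b hb.symm
    have hnotl : ∀ u : P.W, (Sum.inl u : P.W ⊕ (B ⊕ B)) ∉
        Set.range fun a : B => (Sum.inr (Sum.inr a) : P.W ⊕ (B ⊕ B)) :=
      fun u => hnot _ fun b h => by cases h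
    have hnotd : ∀ a : B, (Sum.inr (Sum.inl a) : P.W ⊕ (B ⊕ B)) ∉
        Set.range fun a : B => (Sum.inr (Sum.inr a) : P.W ⊕ (B ⊕ B)) :=
      fun u => hnot _ fun b h => by cases h
    let up : B → W' := fun a => f (.inr (.inr a))
    let down : B → W' := fun a => f (.inr (.inl a))
    let old : P.T → W' := fun t => f (.inl (P.up t))
    have hdown : Function.Injective down := hf.comp (Sum.inr_injective.comp Sum.inl_injective)
    have hold : Function.Injective old := hf.comp (Sum.inl_injective.comp P.up_injective)
    -- The old part is not joined to the vertices placed before.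
    have hlR : ∀ u : P.W, ∀ r ∈ R, ¬ H.Adj (f (.inl u)) r := by
      intro u r hr h
      obtain ⟨t, rfl⟩ := hadj r hr _ (hnotl u) h
      exact hM (.inl u) (.inr (.inr t)) rfl h
    -- The upper vertices are replaced by the lower ones.
    obtain ⟨𝓑₁, h1, hb1, C₁, hC₁, -, hd₁⟩ := hb.exchange (g := up) (h := down) hdown Finset.univ
      (K := ∅) hC (Finset.empty_subset _) (fun a _ => hCup a) (fun a _ => hR _ (hnotd a))
      (fun a _ r hr h => by
        obtain ⟨b, rfl⟩ := hadj r hr _ (hnotd a) h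
        by_cases hab : a = b
        · exact Or.inl (hab ▸ rfl)
        · exact (hM (.inr (.inl a)) (.inr (.inr b)) (if_neg hab) h).elim)
      (by rw [hcards, Finset.card_empty]; omega)
    -- The old terminals outside `B` enter.
    obtain ⟨𝓑₂, h2, hb2, C₂, hC₂, hd₂, ho₂⟩ := hb1.add_clique (h := old) hold Bᶜ
      (K := Finset.univ.image down) hC₁
      (fun u hu => by obtain ⟨a, -, rfl⟩ := Finset.mem_image.1 hu; exact hd₁ a (Finset.mem_univ _))
      (fun t _ => by
        rintro (h | ⟨a, -, h⟩)
        · exact hR _ (hnotl _) h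
        · cases hf h)
      (fun t _ r hr h => by
        rcases hr with hr | ⟨a, -, rfl⟩
        · exact (hlR _ r hr h).elim
        · exact Finset.mem_image_of_mem _ (Finset.mem_univ _))
      (by rw [Finset.card_image_of_injective _ hdown, hcards]; omega)
    -- The lower vertices are replaced by the old terminals in `B`.
    obtain ⟨𝓑₃, h3, hb3, C₃, hC₃, ho₃, hB₃⟩ := hb2.exchange (g := down) (h := fun a : B => old a)
      (hold.comp Subtype.val_injective) Finset.univ
      (K := Bᶜ.image old) hC₂
      (fun u hu => by obtain ⟨a, ha, rfl⟩ := Finset.mem_image.1 hu; exact ho₂ a ha)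
      (fun a _ => hd₂ _ (Finset.mem_image_of_mem _ (Finset.mem_univ _)))
      (fun a _ => by
        rintro ((h | ⟨a, -, h⟩) | ⟨t, ht, h⟩)
        · exact hR _ (hnotl _) h
        · cases hf h
        · exact Finset.mem_compl.1 ht (hold h ▸ a.2))
      (fun a _ r hr h => by
        rcases hr with (hr | ⟨b, -, rfl⟩) | ⟨t, ht, rfl⟩
        · exact (hlR _ r hr h).elim
        · by_cases hab : b = a
          · exact Or.inl (hab ▸ rfl)
          · refine (hM (.inl (P.up a)) (.inr (.inl b)) ?_ h).elim
            refine (link_apply (b := id) _ P.up_injective Function.injective_id _ _).trans ?_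
            exact hc a a.2 b fun h => hab (Subtype.ext h)
        · exact Or.inr (Finset.mem_image_of_mem _ ht))
      (by rw [Finset.card_image_of_injective _ hold, hcards]; omega)
    obtain ⟨𝓑₄, h4, hb4⟩ := P.build H (f ∘ Sum.inl) (hf.comp Sum.inl_injective)
      (fun u v h => hM _ _ h) _ 𝓑₃ hb3
      (fun t => by
        by_cases ht : t ∈ B
        · exact Or.inr ⟨⟨t, ht⟩, by simp, rfl⟩
        · exact Or.inl (Or.inr ⟨t, by simpa using ht, rfl⟩))
      (fun u hu => by
        rintro (((h | ⟨a, -, h⟩) | ⟨t, -, h⟩) | ⟨a, -, h⟩)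
        · exact hR _ (hnotl _) h
        · cases hf h
        · exact hu ⟨t, Sum.inl_injective (hf h)⟩
        · exact hu ⟨a, Sum.inl_injective (hf h)⟩)
      ⟨C₃, hC₃, fun t => by
        by_cases ht : t ∈ B
        · exact hB₃ ⟨t, ht⟩ (Finset.mem_univ _)
        · exact ho₃ _ (Finset.mem_image_of_mem _ (by simpa using ht))⟩
      (fun r hr u hu h => by
        rcases hr with ((hr | ⟨a, -, rfl⟩) | ⟨t, -, rfl⟩) | ⟨a, -, rfl⟩
        · exact (hlR _ r hr h).elim
        · exact (hM (.inl u) (.inr (.inl a)) (link_eq_zero_left _ _ _ hu _) h).elim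
        · exact ⟨t, rfl⟩
        · exact ⟨a, rfl⟩)
    refine ⟨𝓑₄, h1.trans (h2.trans (h3.trans h4)), ?_⟩
    have hset : R ∪ down '' ↑(Finset.univ : Finset B) ∪ old '' ↑(Bᶜ) ∪
        (fun a : B => old a) '' ↑(Finset.univ : Finset B) ∪ Set.range (f ∘ Sum.inl) =
        R ∪ Set.range f := by
      apply Set.Subset.antisymm
      · rintro r ((((hr | ⟨a, -, rfl⟩) | ⟨t, -, rfl⟩) | ⟨a, -, rfl⟩) | ⟨u, rfl⟩)
        · exact Or.inl hr
        all_goals exact Or.inr ⟨_, rfl⟩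
      · rintro r (hr | ⟨u | a | a, rfl⟩)
        · exact Or.inl (Or.inl (Or.inl (Or.inl hr)))
        · exact Or.inr ⟨u, rfl⟩
        · exact Or.inl (Or.inl (Or.inl (Or.inr ⟨a, by simp, rfl⟩)))
        · exact Or.inl (Or.inl (Or.inl (Or.inl (hup a))))
    rwa [hset] at hb4

/-- A part that belongs to the set of all vertices is a graph as required. -/
lemma exists_graph (P : Piece G w Set.univ) (hT : Fintype.card P.T ≤ w + 1) :
    ∃ H : SimpleGraph P.W, H.HasPivotMinor G ∧ H.treeWidth ≤ (w : ℕ∞) := by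
  classical
  let H : SimpleGraph P.W :=
    { Adj := fun u v => P.M u v ≠ 0
      symm := ⟨fun u v h => by rwa [P.M_symm]⟩
      loopless := ⟨fun u h => h (P.M_self u)⟩ }
  have hbit : ∀ u v, H.bit u v = P.M u v := by
    intro u v
    by_cases h : P.M u v = 0
    · rw [h, H.bit_of_not_adj fun h' => h' h]
    · rw [H.bit_of_adj h]
      exact ((show ∀ a : ZMod 2, a ≠ 0 → a = 1 by decide) _ h).symm
  refine ⟨H, ?_, ?_⟩
  · choose e he using fun y => P.exists_orig y trivial
    have hinj : Function.Injective e := fun x y hxy =>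
      Option.some.inj ((he x).symm.trans (hxy ▸ he y))
    refine hasPivotMinor_of_elimination (.refl H) G ⟨e, hinj⟩ fun x => ⟨P.z x, ?_⟩
    · simp only [hbit, P.sum_of_mem x trivial]
      refine ⟨(P.z_orig x _ _ (he x)).trans (if_pos rfl),
        fun y hy => (P.z_orig x _ _ (he y)).trans (if_neg hy.symm), fun u hu => ?_, fun y => ?_⟩
      · cases hu' : P.orig u with
        | none => rfl
        | some y => exact (hu ⟨y, P.orig_inj _ _ y (he y) hu'⟩).elim
      · simp [he y]
  · obtain ⟨𝓑, -, hb, C, hC, -, hup⟩ := (Buildable.empty (H := H) (w := w)).add_clique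
      P.up_injective Finset.univ (K := ∅) (Set.mem_singleton _) subset_rfl (by simp) (by simp)
      (by simpa using hT)
    obtain ⟨𝓑', -, hb'⟩ := P.build H id Function.injective_id (fun u v h h' => h' h) _ 𝓑 hb
      (fun t => Or.inr ⟨t, by simp, rfl⟩)
      (fun u hu => by
        rintro (h | ⟨t, -, rfl⟩)
        · exact h
        · exact hu ⟨t, rfl⟩)
      ⟨C, hC, fun t => hup t (Finset.mem_univ _)⟩
      (fun r hr u _ _ => by
        rcases hr with h | ⟨t, -, rfl⟩
        · exact h.elim
        · exact ⟨t, rfl⟩)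
    rw [Set.range_id, Set.union_univ] at hb'
    exact hb'.treeWidth_le

end Piece

end SimpleGraph

/-! ### Parts from cut-ranks -/

namespace SimpleGraph

/-- Among vertices `lab t` of `X`, some `cutRank X` many have rows, in the adjacency matrix
restricted to the columns outside `X`, that span the rows of all of them. -/
lemma exists_spanning_rows {V : Type u} [Fintype V] (G : SimpleGraph V) (X : Set V) {T : Type*}
    [Fintype T] (lab : T → V) (hlab : ∀ t, lab t ∈ X) :
    ∃ (B : Finset T) (c : T → T → ZMod 2), B.card ≤ G.cutRank X ∧
      (∀ b ∈ B, ∀ a, a ≠ b → c b a = 0) ∧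
      ∀ t, ∀ y ∉ X, G.bit (lab t) y = ∑ a ∈ B, c t a * G.bit (lab a) y := by
  classical
  let ρ : T → ({y // y ∉ X} → ZMod 2) := fun t y => G.bit (lab t) y
  obtain ⟨b, -, -, hspan, hli⟩ := exists_linearIndepOn_extension (K := ZMod 2) (v := ρ)
    (linearIndepOn_empty _ _) (Set.subset_univ ∅)
  have hmem : ∀ t, ∃ c : T → ZMod 2, (t ∈ b → ∀ a, a ≠ t → c a = 0) ∧
      ρ t = ∑ a ∈ b.toFinset, c a • ρ a := by
    intro t
    by_cases ht : t ∈ b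
    · refine ⟨fun a => if a = t then 1 else 0, fun _ a ha => if_neg ha, ?_⟩
      simp [ht]
    · have h := hspan ⟨t, trivial, rfl⟩
      rw [← Set.coe_toFinset b, SetLike.mem_coe,
        Submodule.mem_span_image_finset_iff_exists_fun'] at h
      obtain ⟨c, hc⟩ := h
      exact ⟨c, fun h => absurd h ht, hc.symm⟩
  choose c hc1 hc2 using hmem
  refine ⟨b.toFinset, c, ?_, fun t ht => hc1 t (by simpa using ht), fun t y hy => ?_⟩
  · have h1 := finrank_span_eq_card hli
    rw [Set.toFinset_card, ← h1, cutRank, Matrix.rank_eq_finrank_span_row]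
    refine Submodule.finrank_mono (Submodule.span_mono ?_)
    rintro _ ⟨t, rfl⟩
    refine ⟨⟨lab t, hlab t⟩, ?_⟩
    funext y
    by_cases h : G.Adj (lab t) y <;> simp [ρ, bit, Matrix.row, h]
  · have := congrFun (hc2 t) ⟨y, hy⟩
    simpa [ρ] using this

/-- `IsBranched G k X` : the set `X` can be assembled from single vertices by disjoint unions such
that all the intermediate sets have cut-rank at most `k`. -/
inductive IsBranched {V : Type u} [Fintype V] (G : SimpleGraph V) (k : ℕ) : Set V → Prop
  | leaf (v : V) (h : G.cutRank {v} ≤ k) : IsBranched G k {v}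
  | node {X Y : Set V} (hX : IsBranched G k X) (hY : IsBranched G k Y) (hXY : Disjoint X Y)
      (h : G.cutRank (X ∪ Y) ≤ k) : IsBranched G k (X ∪ Y)

section Pieces

variable {V : Type u} [Fintype V] {G : SimpleGraph V} {k : ℕ}

lemma exists_piece_singleton {v : V} (h : G.cutRank {v} ≤ k) :
    ∃ P : Piece G (2 * k) {v}, Fintype.card P.T ≤ k ∧ Fintype.card P.T ≤ 1 ∧
      Fintype.card P.W = 1 := by
  have hp : ¬ 1 ≤ k → ∀ y, G.bit v y = 0 := by
    intro hk y
    obtain ⟨B, c, hB, -, hrow⟩ := G.exists_spanning_rows {v} (fun _ : Unit => v) fun _ => rfl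
    have hB0 : B = ∅ := Finset.card_eq_zero.1 (by omega)
    by_cases hy : y = v
    · rw [hy, bit_self]
    · rw [hrow () y hy, hB0, Finset.sum_empty]
  let P := Piece.leaf G (2 * k) v (1 ≤ k) hp
  have h1 : Fintype.card P.T ≤ 1 := Fintype.card_le_one_iff_subsingleton.2
    (inferInstanceAs (Subsingleton {_t : PUnit.{u + 1} // 1 ≤ k}))
  refine ⟨P, ?_, h1, Fintype.card_eq_one_iff.2 ⟨PUnit.unit, fun _ => rfl⟩⟩
  by_cases hk : 1 ≤ k
  · omega
  · have : IsEmpty P.T := ⟨fun t : {_t : PUnit.{u + 1} // 1 ≤ k} => hk t.2⟩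
    rw [Fintype.card_eq_zero]
    exact Nat.zero_le _

lemma IsBranched.exists_piece {X : Set V} (h : IsBranched G k X) :
    ∃ P : Piece G (2 * k) X, Fintype.card P.T ≤ k ∧
      Fintype.card P.W + 2 * k ≤ (2 * k + 1) * X.ncard := by
  induction h with
  | leaf v h =>
    obtain ⟨P, h1, -, h2⟩ := exists_piece_singleton h
    refine ⟨P, h1, ?_⟩
    rw [h2, Set.ncard_singleton]
    omega
  | @node X Y _ _ hXY h ihX ihY =>
    obtain ⟨P, hP1, hP2⟩ := ihX
    obtain ⟨Q, hQ1, hQ2⟩ := ihY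
    let J := P.join Q hXY
    have hJT : Fintype.card J.T = Fintype.card P.T + Fintype.card Q.T := Fintype.card_sum
    have hJW : Fintype.card J.W = Fintype.card P.W + Fintype.card Q.W := Fintype.card_sum
    obtain ⟨B, c, hB, hc, hrow⟩ := G.exists_spanning_rows (X ∪ Y) J.lab J.lab_mem
    let S := J.shrink B c hc hrow (by omega)
    have hST : Fintype.card S.T = B.card := Fintype.card_coe B
    have hSW : Fintype.card S.W = Fintype.card J.W + (B.card + B.card) := by
      rw [← Fintype.card_coe B, ← Fintype.card_sum, ← Fintype.card_sum]
      rfl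
    refine ⟨S, by omega, ?_⟩
    rw [Set.ncard_union_eq hXY, mul_add]
    omega

/-- Assembling the whole graph at the end from three parts, one of them a single vertex. -/
lemma IsBranched.exists_graph {X Y : Set V} {v : V} (hX : IsBranched G k X)
    (hY : IsBranched G k Y) (hXY : Disjoint X Y) (hv : v ∉ X ∪ Y) (hVv : X ∪ Y ∪ {v} = Set.univ)
    (hvk : G.cutRank {v} ≤ k) :
    ∃ (W : Type u) (_ : Fintype W) (H : SimpleGraph W), H.HasPivotMinor G ∧
      H.treeWidth ≤ ((2 * k : ℕ) : ℕ∞) ∧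
      Fintype.card W + 6 * k ≤ (2 * k + 1) * Fintype.card V := by
  obtain ⟨P, hP1, hP2⟩ := hX.exists_piece
  obtain ⟨Q, hQ1, hQ2⟩ := hY.exists_piece
  obtain ⟨L, -, hL1, hL2⟩ := exists_piece_singleton hvk
  have hd : Disjoint (X ∪ Y) {v} := Set.disjoint_singleton_right.2 hv
  have hcard : Fintype.card V = X.ncard + Y.ncard + 1 := by
    rw [← Nat.card_eq_fintype_card, ← Set.ncard_univ, ← hVv, Set.ncard_union_eq hd,
      Set.ncard_union_eq hXY, Set.ncard_singleton]
  let J := (P.join Q hXY).join L hd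
  have hJT : Fintype.card J.T = Fintype.card P.T + Fintype.card Q.T + Fintype.card L.T := by
    rw [← Fintype.card_sum, ← Fintype.card_sum]
    rfl
  have hJW : Fintype.card J.W = Fintype.card P.W + Fintype.card Q.W + Fintype.card L.W := by
    rw [← Fintype.card_sum, ← Fintype.card_sum]
    rfl
  have key : ∀ Z : Set V, Z = Set.univ → ∀ J : Piece G (2 * k) Z,
      Fintype.card J.T ≤ 2 * k + 1 →
      ∃ H : SimpleGraph J.W, H.HasPivotMinor G ∧ H.treeWidth ≤ ((2 * k : ℕ) : ℕ∞) := by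
    rintro _ rfl J hJ
    exact J.exists_graph hJ
  obtain ⟨H, h1, h2⟩ := key _ hVv J (by omega)
  refine ⟨J.W, inferInstance, H, h1, h2, ?_⟩
  rw [hcard, mul_add, mul_add]
  omega

end Pieces

end SimpleGraph

/-! ### Rank-decompositions as branchings -/

namespace SimpleGraph

section Branches

variable {N : Type*} {T : SimpleGraph N}

/-- The nodes on the side of `x` when the edge `xy` of `T` is removed. -/
def branch (T : SimpleGraph N) (x y : N) : Set N :=
  {t | (T.deleteEdges {s(x, y)}).Reachable x t}

lemma mem_branch_self (x y : N) : x ∈ T.branch x y := Reachable.refl x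

/-- A walk that avoids `y` stays on one side of each edge at `y`. -/
lemma reachable_of_walk_avoiding {a t x y : N} (p : T.Walk a t) (hp : y ∉ p.support) :
    (T.deleteEdges {s(x, y)}).Reachable a t := by
  refine ⟨p.toDeleteEdges _ fun e he h => ?_⟩
  rw [Set.mem_singleton_iff] at h
  exact hp (p.snd_mem_support_of_mem_edges (h ▸ he))

lemma IsAcyclic.notMem_branch (hT : T.IsAcyclic) {x y : N} (h : T.Adj x y) :
    y ∉ T.branch x y := by
  have := isAcyclic_iff_forall_adj_isBridge.1 hT h
  exact isBridge_iff.1 this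

/-- In a tree, the side of `x` of an edge `xy` consists of the nodes that can be reached from `x`
while avoiding `y`. -/
lemma IsAcyclic.mem_branch_iff (hT : T.IsAcyclic) {x y t : N} (h : T.Adj x y) :
    t ∈ T.branch x y ↔ ∃ p : T.Walk x t, y ∉ p.support := by
  classical
  refine ⟨fun ⟨p⟩ => ⟨p.mapLe (deleteEdges_le _), fun hy => ?_⟩,
    fun ⟨p, hp⟩ => reachable_of_walk_avoiding p hp⟩
  rw [Walk.support_mapLe_eq_support] at hy
  exact hT.notMem_branch h ⟨p.takeUntil y hy⟩

/-- Stepping from `x` to any neighbour but `y`, one passes from a branch to a smaller one. -/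
lemma IsAcyclic.branch_subset (hT : T.IsAcyclic) {x y a : N} (h : T.Adj x y) (ha : T.Adj a x)
    (hay : a ≠ y) : T.branch a x ⊆ T.branch x y := by
  intro t ht
  obtain ⟨p, hp⟩ := (hT.mem_branch_iff ha).1 ht
  have h1 : (T.deleteEdges {s(x, y)}).Reachable a t := by
    rw [Sym2.eq_swap]
    exact reachable_of_walk_avoiding p hp
  refine Reachable.trans (Adj.reachable ?_) h1
  rw [deleteEdges_adj]
  refine ⟨ha.symm, fun h' => ?_⟩
  rcases Sym2.eq_iff.1 (Set.mem_singleton_iff.1 h') with ⟨-, h'⟩ | ⟨h', -⟩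
  · exact hay h'
  · exact h.ne h'

/-- A path from `x` does not return to `x` after its first step. -/
lemma Reachable.exists_walk_avoiding {x t : N} (h : T.Reachable x t) (hxt : x ≠ t) :
    ∃ (a : N) (_ : T.Adj x a) (p : T.Walk a t), x ∉ p.support := by
  classical
  obtain ⟨p, hp⟩ := h.exists_isPath
  cases p with
  | nil => exact (hxt rfl).elim
  | cons ha q => exact ⟨_, ha, q, ((Walk.cons_isPath_iff _ _).1 hp).2⟩

lemma IsAcyclic.branch_eq (hT : T.IsAcyclic) {x y : N} (h : T.Adj x y) {t : N}
    (hxt : t ≠ x) : t ∈ T.branch x y ↔ ∃ a, a ≠ y ∧ T.Adj a x ∧ t ∈ T.branch a x := by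
  constructor
  · intro ht
    obtain ⟨a, ha, p, hp⟩ := Reachable.exists_walk_avoiding ht hxt.symm
    rw [deleteEdges_adj] at ha
    refine ⟨a, fun h' => ha.2 (by rw [h']; rfl), ha.1.symm, (hT.mem_branch_iff ha.1.symm).2
      ⟨p.mapLe (deleteEdges_le _), by rwa [Walk.support_mapLe_eq_support]⟩⟩
  · rintro ⟨a, hay, ha, ht⟩
    exact hT.branch_subset h ha hay ht

lemma IsAcyclic.disjoint_branch (hT : T.IsAcyclic) {x a b : N} (ha : T.Adj a x) (hb : T.Adj b x)
    (hab : a ≠ b) : Disjoint (T.branch a x) (T.branch b x) := by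
  rw [Set.disjoint_left]
  intro t hta htb
  obtain ⟨p, hp⟩ := (hT.mem_branch_iff hb).1 htb
  have h1 : (T.deleteEdges {s(a, x)}).Reachable b t := reachable_of_walk_avoiding p hp
  refine hT.notMem_branch ha ((hta.trans h1.symm).trans (Adj.reachable ?_))
  rw [deleteEdges_adj]
  refine ⟨hb, fun h' => ?_⟩
  rcases Sym2.eq_iff.1 (Set.mem_singleton_iff.1 h') with ⟨h', -⟩ | ⟨h', -⟩
  · exact hab h'.symm
  · exact hb.ne h'

end Branches

namespace RankDecomposition

variable {V : Type u} {G : SimpleGraph V} (D : RankDecomposition G)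

attribute [local instance] RankDecomposition.fintypeNode

lemma mem_side_iff {x y : D.Node} {v : V} :
    v ∈ D.side x y ↔ (D.leafEquiv v : D.Node) ∈ D.tree.branch x y := Iff.rfl

lemma cutRank_side_le [Fintype V] {k : ℕ} (hk : D.width ≤ k) {x y : D.Node} (h : D.tree.Adj x y) :
    G.cutRank (D.side x y) ≤ k := by
  have : (G.cutRank (D.side x y) : ℕ∞) ≤ D.width := by
    refine le_trans ?_ (le_iSup _ x)
    refine le_trans ?_ (le_iSup _ y)
    exact le_iSup (fun _ : D.tree.Adj x y => (G.cutRank (D.side x y) : ℕ∞)) h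
  exact_mod_cast this.trans hk

lemma eq_of_isLeaf {x y a : D.Node} (hx : D.tree.IsLeaf x) (h : D.tree.Adj x y)
    (ha : D.tree.Adj x a) : a = y := by
  classical
  exact ((degree_eq_one_iff_existsUnique_adj ..).1 hx).unique ha h

/-- The side of an edge at a leaf. -/
lemma side_of_isLeaf {x y : D.Node} (hx : D.tree.IsLeaf x) (h : D.tree.Adj x y) :
    D.side x y = {D.leafEquiv.symm ⟨x, hx⟩} := by
  ext v
  rw [mem_side_iff, Set.mem_singleton_iff, Equiv.eq_symm_apply, Subtype.ext_iff]
  refine ⟨fun hv => by_contra fun hvx => ?_, fun hv => hv ▸ mem_branch_self _ _⟩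
  obtain ⟨a, hay, ha, -⟩ := (D.isSubcubicTree.isTree.isAcyclic.branch_eq h hvx).1 hv
  exact hay (D.eq_of_isLeaf hx h ha.symm)

/-- At an inner node, the side of an edge splits into the sides of the two other edges. -/
lemma exists_side_eq_union {x y : D.Node} (hx : ¬ D.tree.IsLeaf x) (h : D.tree.Adj x y) :
    ∃ a b, D.tree.Adj a x ∧ D.tree.Adj b x ∧ a ≠ y ∧ b ≠ y ∧
      D.side x y = D.side a x ∪ D.side b x ∧ Disjoint (D.side a x) (D.side b x) := by
  classical
  have hT := D.isSubcubicTree.isTree.isAcyclic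
  have h3 := D.isSubcubicTree.degree_eq_three x hx
  obtain ⟨a, b, hab, hn⟩ : ∃ a b, a ≠ b ∧ ∀ z, (z ≠ y ∧ D.tree.Adj z x) ↔ (z = a ∨ z = b) := by
    have h2 : ((D.tree.neighborFinset x).erase y).card = 2 := by
      rw [Finset.card_erase_of_mem ((mem_neighborFinset ..).2 h), card_neighborFinset_eq_degree, h3]
    obtain ⟨a, b, hab, hn⟩ := Finset.card_eq_two.1 h2
    refine ⟨a, b, hab, fun z => ?_⟩
    have := Finset.ext_iff.1 hn z
    simpa [D.tree.adj_comm x z] using this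
  obtain ⟨hay, ha⟩ := (hn a).2 (Or.inl rfl)
  obtain ⟨hby, hb⟩ := (hn b).2 (Or.inr rfl)
  refine ⟨a, b, ha, hb, hay, hby, ?_, ?_⟩
  · ext v
    rw [Set.mem_union, mem_side_iff, mem_side_iff, mem_side_iff,
      hT.branch_eq h fun h' => hx (h' ▸ (D.leafEquiv v).2)]
    constructor
    · rintro ⟨z, hzy, hz, hv⟩
      rcases (hn z).1 ⟨hzy, hz⟩ with rfl | rfl
      · exact Or.inl hv
      · exact Or.inr hv
    · rintro (hv | hv)
      · exact ⟨a, hay, ha, hv⟩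
      · exact ⟨b, hby, hb, hv⟩
  · exact Set.disjoint_left.2 fun v hva hvb =>
      Set.disjoint_left.1 (hT.disjoint_branch ha hb hab) hva hvb

lemma isBranched_side [Fintype V] {k : ℕ} (hk : D.width ≤ k) {x y : D.Node} (h : D.tree.Adj x y) :
    IsBranched G k (D.side x y) := by
  have hT := D.isSubcubicTree.isTree.isAcyclic
  induction hn : (D.tree.branch x y).ncard using Nat.strong_induction_on generalizing x y with
  | _ n ih =>
    have hcut := D.cutRank_side_le hk h
    by_cases hx : D.tree.IsLeaf x
    · rw [D.side_of_isLeaf hx h] at hcut ⊢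
      exact .leaf _ hcut
    · obtain ⟨a, b, ha, hb, hay, hby, hside, hdisj⟩ := D.exists_side_eq_union hx h
      have hlt : ∀ a, D.tree.Adj a x → a ≠ y → (D.tree.branch a x).ncard < n := by
        intro a ha hay
        rw [← hn]
        refine Set.ncard_lt_ncard ⟨hT.branch_subset h ha hay, fun hsub => ?_⟩
        exact hT.notMem_branch ha (hsub (mem_branch_self x y))
      rw [hside] at hcut ⊢
      exact .node (ih _ (hlt a ha hay) ha rfl) (ih _ (hlt b hb hby) hb rfl) hdisj hcut

end RankDecomposition

end SimpleGraph

theorem theorem3p1 (k : ℕ) {V : Type u} [Fintype V] (G : SimpleGraph V)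
    (hk : G.rankWidth ≤ k) (hV : 3 ≤ Fintype.card V) :
    ∃ (W : Type u) (_ : Fintype W) (H : SimpleGraph W),
      (∃ (U : Type u) (G' : SimpleGraph U), H.IsPivotMinor G' ∧ Nonempty (G' ≃g G)) ∧
      H.treeWidth ≤ ((2 * k : ℕ) : ℕ∞) ∧
      (Fintype.card W : ℤ) ≤ (2 * (k : ℤ) + 1) * (Fintype.card V : ℤ) - 6 * (k : ℤ) := by
  classical
  obtain ⟨D, hD⟩ : ∃ D : SimpleGraph.RankDecomposition G, D.width ≤ k := by
    rw [SimpleGraph.rankWidth, if_neg (by omega)] at hk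
    have hne : Nonempty (SimpleGraph.RankDecomposition G) := by
      by_contra hempty
      rw [not_nonempty_iff] at hempty
      rw [iInf_of_empty, top_le_iff] at hk
      exact ENat.natCast_ne_top k hk
    obtain ⟨D, hD⟩ := ENat.exists_eq_iInf fun D : SimpleGraph.RankDecomposition G => D.width
    exact ⟨D, hD.trans_le hk⟩
  let _ := D.fintypeNode
  have hT := D.isSubcubicTree.isTree
  obtain ⟨v⟩ : Nonempty V := Fintype.card_pos_iff.1 (by omega)
  -- The decomposition tree is rooted at the leaf `r` of some vertex `v`.
  obtain ⟨r, hr, hrv⟩ : ∃ r, ∃ hr : D.tree.IsLeaf r, D.leafEquiv v = ⟨r, hr⟩ := ⟨_, _, rfl⟩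
  have : Nontrivial D.Node := Fintype.one_lt_card_iff_nontrivial.1 D.isSubcubicTree.two_le_card
  obtain ⟨y, hy⟩ := hT.connected.preconnected.exists_adj_of_nontrivial r
  have hside : D.side y r = {v}ᶜ := by
    have hv : (D.leafEquiv v : D.Node) = r := by rw [hrv]
    ext u
    rw [D.mem_side_iff, Set.mem_compl_singleton_iff]
    refine ⟨?_, fun hu => ?_⟩
    · rintro hu rfl
      exact hT.isAcyclic.notMem_branch hy.symm (hv ▸ hu)
    · obtain ⟨a, ha, p, hp⟩ := (hT.connected.preconnected r (D.leafEquiv u)).exists_walk_avoiding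
        fun h => hu (D.leafEquiv.injective (Subtype.ext (h.symm.trans hv.symm)))
      obtain rfl := D.eq_of_isLeaf hr hy ha
      exact (hT.isAcyclic.mem_branch_iff hy.symm).2 ⟨p, hp⟩
  have hside' : D.side r y = {v} := by
    rw [D.side_of_isLeaf hr hy, ← hrv, Equiv.symm_apply_apply]
  have hyleaf : ¬ D.tree.IsLeaf y := by
    intro h
    have h1 := congrArg Set.ncard (D.side_of_isLeaf h hy.symm)
    rw [hside, Set.ncard_singleton] at h1
    have h2 := Set.ncard_add_ncard_compl {v}
    rw [Set.ncard_singleton, Nat.card_eq_fintype_card] at h2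
    omega
  obtain ⟨a, b, ha, hb, -, -, hu, hd⟩ := D.exists_side_eq_union hyleaf hy.symm
  rw [hside] at hu
  have hcut := D.cutRank_side_le hD hy
  rw [hside'] at hcut
  obtain ⟨W, hW, H, h1, h2, h3⟩ := (D.isBranched_side hD ha).exists_graph
    (D.isBranched_side hD hb) hd (v := v) (by rw [← hu]; simp)
    (by rw [← hu, Set.compl_union_self]) hcut
  refine ⟨W, hW, H, h1, h2, ?_⟩
  zify at h3
  linarith
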